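/- Let $k$ be a field and let $Q$ be the straightly oriented quiver $1\to 2\to\cdots\to n$ of type $\mathbb{A}_n$, $n\ge 0$. A finite-dimensional representation $V$ of $Q$ over $k$ is exceptional if $\mathrm{End}(V)$ is a division ring and $\mathrm{Ext}^i(V,V)=0$ for all $i\ge 1$. An exceptional sequence is a sequence $(V_1,\dots,V_m)$ of exceptional representations with $\mathrm{Hom}(V_i,V_j)=0=\mathrm{Ext}^1(V_i,V_j)$ for all $j<i$; it is complete if $m=n$. A complete exceptional set is a set of isomorphism classes of representations of $Q$ whose members can be ordered so as to form a complete exceptional sequence. Then the number $E(n)$ of complete exceptional sets over $Q$ is finite and $$E(n)=\frac{1}{3n+1}\binom{3n+1}{n}=\frac{1}{2n+1}\binom{3n}{n}.$$ -/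

import Mathlib

open CategoryTheory

universe u

section Representations

variable (k : Type u) [Field k] (Q : Type) [Quiver.{0} Q]

/-- Representations of the quiver `Q` by finite-dimensional `k`-vector spaces: functors from the
free (path) category of `Q` to the category of finite-dimensional `k`-vector spaces. For a finite
acyclic quiver this category is equivalent to that of finitely generated modules over the path
algebra of `Q`. -/
abbrev QuiverRep : Type _ := Paths Q ⥤ FGModuleCat.{u} k

variable {k Q}

/-- The group `Ext^i(V, W)`, taken in the abelian category of representations, vanishes. -/
def ExtVanishes (V W : QuiverRep k Q) (i : ℕ) : Prop :=
  letI : HasExt (QuiverRep k Q) := HasExt.standard (QuiverRep k Q)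
  Subsingleton (Abelian.Ext V W i)

/-- `V` is exceptional: its endomorphism ring is a division ring, and `Ext^i(V, V) = 0` for all
`i ≥ 1`. -/
structure IsExceptional (V : QuiverRep k Q) : Prop where
  nontrivial_end : Nontrivial (End V)
  isUnit_of_ne_zero : ∀ f : End V, f ≠ 0 → IsUnit f
  ext_self : ∀ i : ℕ, 1 ≤ i → ExtVanishes V V i

/-- `(V 0, …, V (m - 1))` is an exceptional sequence: every term is exceptional and
`Hom(V i, V j) = 0 = Ext^1(V i, V j)` whenever `j < i`. -/
structure IsExceptionalSequence {m : ℕ} (V : Fin m → QuiverRep k Q) : Prop where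
  exceptional : ∀ i, IsExceptional (V i)
  hom_eq_zero : ∀ i j, j < i → ∀ f : V i ⟶ V j, f = 0
  ext_eq_zero : ∀ i j, j < i → ExtVanishes (V i) (V j) 1

variable (k Q)

/-- Isomorphism classes of representations of `Q`. -/
abbrev RepClass : Type _ := Quotient (isIsomorphicSetoid (QuiverRep k Q))

/-- The complete exceptional sets over `Q`, representations being considered up to isomorphism:
the sets of isomorphism classes whose members can be ordered to form an exceptional sequence with
as many terms as `Q` has vertices. (The terms of an exceptional sequence are pairwise
non-isomorphic, since a nonzero identity map would otherwise give a nonzero morphism backwards.) -/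
def completeExceptionalSets [Fintype Q] : Set (Set (RepClass k Q)) :=
  {S | ∃ V : Fin (Fintype.card Q) → QuiverRep k Q, IsExceptionalSequence V ∧
    S = Set.range fun i => (Quotient.mk (isIsomorphicSetoid (QuiverRep k Q)) (V i))}

end Representations

/-- The vertex set of the straightly oriented quiver `1 → 2 → ⋯ → n` of type `A_n`; the vertex `i`
of the quiver is the element `i - 1` of `Fin n`. -/
def StraightA (n : ℕ) : Type := Fin n

instance (n : ℕ) : Fintype (StraightA n) := inferInstanceAs (Fintype (Fin n))

/-- There is exactly one arrow from `i` to `i + 1`, and there are no other arrows. -/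
instance (n : ℕ) : Quiver.{0} (StraightA n) where
  Hom i j := PLift (Fin.val (n := n) i + 1 = Fin.val (n := n) j)

/-! An exceptional representation is isomorphic to an interval representation `interval k n a b`, `0
≤ a < b ≤ n`: an arbitrary nonzero representation has an interval as a retract
(`exists_interval_retract`), and a nonzero idempotent in a division ring is the identity. Drawing
`[a, b)` as an edge between points `a` and `b` of the line `0, …, n` turns the problem into
combinatorics. Morphisms out of an interval are read off the image of its generator, and `Ext` off
the resolution of `[a, b)` by the projectives `[b, n)` and `[a, n)`. The outcome is that `Hom` or
`Ext^1` from `x` to `y` is nonzero exactly when `Link x y` (`interval_link_iff`), so complete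
exceptional sets correspond to sets of `n` edges that can be ordered without backward links.

Crossing edges are linked both ways, and links orient the edges around each point so that a cycle of
edges would produce a cycle of links. Orderable sets are therefore noncrossing forests, and those
with `n` edges are the noncrossing trees on `n + 1` points (`LinkMono.card_le`). Conversely a
noncrossing tree has an ordering without backward links (`pairwise_edgeList`). Removing the longest
edge at the leftmost point splits a noncrossing tree into three smaller ones, which encodes it as a
ternary tree with `n` nodes.

Ternary trees are counted through forests: `r` trees with `n` nodes in all number `r / (3n + r)`
times `(3n + r).choose n`, by induction on the first tree; the theorem is the case `r = 1`. -/

/-! ### Counting ternary trees -/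

/-- Ternary trees. -/
inductive TernaryTree : Type
  | leaf : TernaryTree
  | node : TernaryTree → TernaryTree → TernaryTree → TernaryTree

namespace TernaryTree

/-- The number of internal nodes of a ternary tree. -/
def size : TernaryTree → ℕ
  | leaf => 0
  | node a b c => size a + size b + size c + 1

/-- The ordered forests of `r` ternary trees with `n` internal nodes altogether. -/
def forests (n r : ℕ) : Set (List TernaryTree) :=
  {L | L.length = r ∧ (L.map size).sum = n}

/-- Join the first three trees of a forest under a new root. -/
def joinThree : List TernaryTree → List TernaryTree
  | a :: b :: c :: L => node a b c :: L
  | L => L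

theorem forests_zero_zero : forests 0 0 = {[]} := by
  ext L
  constructor
  · rintro ⟨h, -⟩
    exact List.length_eq_zero_iff.1 h
  · rintro rfl
    exact ⟨rfl, rfl⟩

theorem forests_succ_zero (n : ℕ) : forests (n + 1) 0 = ∅ := by
  ext L
  simp only [forests, Set.mem_ofPred_eq, Set.mem_empty_iff_false, iff_false, not_and]
  intro h
  rw [List.length_eq_zero_iff.1 h]
  simp

theorem forests_zero_succ (r : ℕ) :
    forests 0 (r + 1) = List.cons leaf '' forests 0 r := by
  ext L
  constructor
  · rintro ⟨h, h'⟩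
    match L, h, h' with
    | leaf :: L, h, h' =>
      exact ⟨L, ⟨by simpa using h, by simpa [size] using h'⟩, rfl⟩
    | node a b c :: L, h, h' => simp [size] at h'
  · rintro ⟨L, ⟨h, h'⟩, rfl⟩
    exact ⟨by simp [h], by simp [size, h']⟩

/-- The first tree is either a leaf, which is dropped, or has a root, whose removal loses one node
and leaves two more trees. -/
theorem forests_succ_succ (n r : ℕ) :
    forests (n + 1) (r + 1) =
      List.cons leaf '' forests (n + 1) r ∪ joinThree '' forests n (r + 3) := by
  ext L
  constructor
  · rintro ⟨h, h'⟩
    match L, h, h' with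
    | leaf :: L, h, h' =>
      exact Or.inl ⟨L, ⟨by simpa using h, by simpa [size] using h'⟩, rfl⟩
    | node a b c :: L, h, h' =>
      refine Or.inr ⟨a :: b :: c :: L, ⟨by simpa using h, ?_⟩, rfl⟩
      simp [size] at h' ⊢
      omega
  · rintro (⟨L, ⟨h, h'⟩, rfl⟩ | ⟨L, ⟨h, h'⟩, rfl⟩)
    · exact ⟨by simp [h], by simp [size, h']⟩
    · match L, h, h' with
      | a :: b :: c :: L, h, h' =>
        refine ⟨by simpa [joinThree] using h, ?_⟩
        simp [joinThree, size] at h' ⊢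
        omega

theorem joinThree_injOn (n r : ℕ) : Set.InjOn joinThree (forests n (r + 3)) := by
  rintro L ⟨h, -⟩ L' ⟨h', -⟩ e
  match L, L', h, h', e with
  | a :: b :: c :: L, a' :: b' :: c' :: L', h, h', e =>
    simp only [joinThree, List.cons.injEq, node.injEq] at e
    obtain ⟨⟨rfl, rfl, rfl⟩, rfl⟩ := e
    rfl

theorem disjoint_leaf_joinThree (n r : ℕ) :
    Disjoint (List.cons leaf '' forests (n + 1) r) (joinThree '' forests n (r + 3)) := by
  rw [Set.disjoint_left]
  rintro _ ⟨L, -, rfl⟩ ⟨L', ⟨h, -⟩, e⟩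
  match L', h, e with
  | a :: b :: c :: L', h, e => simp [joinThree] at e

/-- The inductive step of the forest formula. All three binomial coefficients are rational multiples
of `(3n + r + 3).choose n`, after which it is an identity of rational functions. -/
theorem choose_succ_rec (n r : ℕ) (x y : ℚ)
    (hx : (3 * (n + 1) + r : ℚ) * x = r * (Nat.choose (3 * (n + 1) + r) (n + 1) : ℚ))
    (hy : (3 * n + (r + 3) : ℚ) * y = (r + 3) * (Nat.choose (3 * n + (r + 3)) n : ℚ)) :
    (3 * (n + 1) + (r + 1) : ℚ) * (x + y) =
      (r + 1) * (Nat.choose (3 * (n + 1) + (r + 1)) (n + 1) : ℚ) := by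
  have e1 := Nat.add_one_mul_choose_eq (3 * n + r + 3) n
  have e2 := Nat.choose_succ_right_eq (3 * n + r + 3) n
  rw [show 3 * n + r + 3 - n = 2 * n + r + 3 by omega] at e2
  rw [show 3 * (n + 1) + r = 3 * n + r + 3 by ring] at hx
  rw [show 3 * n + (r + 3) = 3 * n + r + 3 by ring] at hy
  rw [show 3 * (n + 1) + (r + 1) = 3 * n + r + 3 + 1 by ring]
  generalize Nat.choose (3 * n + r + 3) n = A at *
  generalize Nat.choose (3 * n + r + 3) (n + 1) = B at *
  generalize Nat.choose (3 * n + r + 3 + 1) (n + 1) = C at *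
  have e1' : ((3 * n + r + 3 + 1 : ℚ)) * A = C * (n + 1) := by exact_mod_cast e1
  have e2' : (B * (n + 1) : ℚ) = A * (2 * n + r + 3) := by exact_mod_cast e2
  have h0 : (3 * n + r + 3 : ℚ) ≠ 0 := by positivity
  have h1 : (n + 1 : ℚ) ≠ 0 := by positivity
  have hB : (B : ℚ) = A * (2 * n + r + 3) / (n + 1) := by field_simp; linarith
  have hC : (C : ℚ) = (3 * n + r + 3 + 1) * A / (n + 1) := by field_simp; linarith
  have hx' : x = r * B / (3 * n + r + 3) := by field_simp; linarith
  have hy' : y = (r + 3) * A / (3 * n + r + 3) := by field_simp; linarith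
  rw [hx', hy', hB, hC]
  field_simp
  ring

/-- The number of trees `r` is kept general because removing a root does not preserve the class of
single trees. Denominators are cleared in the formula. -/
theorem forests_count (n r : ℕ) :
    (forests n r).Finite ∧ ((n, r) ≠ (0, 0) →
      (3 * n + r : ℚ) * ((forests n r).ncard : ℚ) = r * (Nat.choose (3 * n + r) n : ℚ)) := by
  induction n generalizing r with
  | zero =>
    have key : (forests 0 r).Finite ∧ (forests 0 r).ncard = 1 := by
      induction r with
      | zero => rw [forests_zero_zero]; simp
      | succ r ih =>
        rw [forests_zero_succ]
        refine ⟨ih.1.image _, ?_⟩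
        rw [Set.ncard_image_of_injective _ (List.cons_injective), ih.2]
    refine ⟨key.1, fun _ => ?_⟩
    rw [key.2]
    simp
  | succ n ih =>
    induction r with
    | zero => rw [forests_succ_zero]; simp
    | succ r ihr =>
      have h3 := ih (r + 3)
      rw [forests_succ_succ]
      refine ⟨(ihr.1.image _).union (h3.1.image _), fun _ => ?_⟩
      rw [Set.ncard_union_eq (disjoint_leaf_joinThree n r) (ihr.1.image _) (h3.1.image _),
        Set.ncard_image_of_injective _ (List.cons_injective),
        (joinThree_injOn n r).ncard_image]
      have := choose_succ_rec n r _ _ (by simpa using ihr.2 (by simp))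
        (by simpa using h3.2 (by simp))
      push_cast at this ⊢
      exact this

/-- The ternary trees with `n` internal nodes. -/
def ofSize (n : ℕ) : Set TernaryTree := {t | t.size = n}

theorem ofSize_count (n : ℕ) :
    (ofSize n).Finite ∧
      (3 * n + 1 : ℚ) * ((ofSize n).ncard : ℚ) = (Nat.choose (3 * n + 1) n : ℚ) := by
  have h : forests n 1 = (fun t => [t]) '' ofSize n := by
    ext L
    constructor
    · rintro ⟨h, h'⟩
      obtain ⟨t, rfl⟩ := List.length_eq_one_iff.1 h
      exact ⟨t, by simpa [ofSize] using h', rfl⟩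
    · rintro ⟨t, ht, rfl⟩
      exact ⟨rfl, by simpa [ofSize] using ht⟩
  have hinj : Function.Injective (fun t : TernaryTree => [t]) := fun _ _ h => by simpa using h
  have hc := forests_count n 1
  rw [h, Set.finite_image_iff hinj.injOn, Set.ncard_image_of_injective _ hinj] at hc
  exact ⟨hc.1, by simpa using hc.2 (by simp)⟩

end TernaryTree

/-! ### Links between edges and noncrossing forests -/

/-- The condition on pairs of integers under which there is a nonzero morphism or a nonsplit
extension between the corresponding interval representations. -/
def Link (x y : ℕ × ℕ) : Prop :=
  (y.1 ≤ x.1 ∧ x.1 < y.2 ∧ y.2 ≤ x.2) ∨ (x.1 < y.1 ∧ y.1 ≤ x.2 ∧ x.2 < y.2)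

/-- All members of `F` are edges `(a, b)` with `l ≤ a < b ≤ u`. -/
def EdgesIn (l u : ℕ) (F : Finset (ℕ × ℕ)) : Prop :=
  ∀ x ∈ F, l ≤ x.1 ∧ x.1 < x.2 ∧ x.2 ≤ u

/-- The function `r` increases along the links between different members of `F`. -/
def LinkMono (r : ℕ × ℕ → ℕ) (F : Finset (ℕ × ℕ)) : Prop :=
  ∀ x ∈ F, ∀ y ∈ F, x ≠ y → Link x y → r x < r y

theorem LinkMono.subset {r : ℕ × ℕ → ℕ} {F G : Finset (ℕ × ℕ)} (h : LinkMono r F) (hG : G ⊆ F) :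
    LinkMono r G := fun x hx y hy => h x (hG hx) y (hG hy)

/-- Crossing edges are linked in both directions, by an extension one way and by a morphism the
other way. -/
theorem LinkMono.not_crossing {r : ℕ × ℕ → ℕ} {F : Finset (ℕ × ℕ)} (h : LinkMono r F)
    {a b c d : ℕ} (hx : (a, b) ∈ F) (hy : (c, d) ∈ F) (h₁ : a < c) (h₂ : c < b) (h₃ : b < d) :
    False := by
  have hne : (a, b) ≠ (c, d) := fun e => by
    have := congrArg Prod.fst e
    simp only at this
    omega
  have h1 := h _ hx _ hy hne (Or.inr ⟨h₁, h₂.le, h₃⟩)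
  have h2 := h _ hy _ hx hne.symm (Or.inl ⟨h₁.le, h₂, h₃.le⟩)
  omega

theorem exists_max_neighbor (F : Finset (ℕ × ℕ)) (c : ℕ) (h : ∃ d, (c, d) ∈ F) :
    ∃ b, (c, b) ∈ F ∧ ∀ d, (c, d) ∈ F → d ≤ b := by
  have hne : (F.filter fun x => x.1 = c).Nonempty := by
    obtain ⟨d, hd⟩ := h
    exact ⟨(c, d), by simp [hd]⟩
  obtain ⟨⟨a, b⟩, hb, hmax⟩ := Finset.exists_max_image _ Prod.snd hne
  simp only [Finset.mem_filter] at hb hmax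
  obtain ⟨hb, rfl⟩ := hb
  exact ⟨b, hb, fun d hd => hmax (a, d) ⟨hd, rfl⟩⟩

/-- Below an edge `(l, b)`, the other edges of a noncrossing forest leave a gap. -/
theorem LinkMono.exists_gap_aux {r : ℕ × ℕ → ℕ} {F : Finset (ℕ × ℕ)} (h : LinkMono r F)
    {l b : ℕ} (hF : ∀ x ∈ F, x.1 < x.2) (he : (l, b) ∈ F) (k c : ℕ) (hk : b - c ≤ k)
    (hlc : l ≤ c) (hcb : c < b) (hover : ∀ a d, (a, d) ∈ F → l ≤ a → a < c → c < d → d ≤ b →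
      (a, d) = (l, b))
    (hc : c = l ∨ ∃ a, (a, c) ∈ F ∧ r (l, b) < r (a, c)) :
    ∃ m, c ≤ m ∧ m < b ∧ ∀ a d, (a, d) ∈ F → l ≤ a → a ≤ m → m < d → d ≤ b → (a, d) = (l, b) := by
  -- A walk to the right from `l`: at each point `c` take the longest edge other than `(l, b)` that
  -- stays within `b`. Ranks increase along the walk, and where it stops is the gap.
  induction k generalizing c with
  | zero => omega
  | succ k ih =>
    by_cases hex : ∃ d, (c, d) ∈ F.filter fun x => x.2 ≤ b ∧ x ≠ (l, b)
    · obtain ⟨d, hd, hmax⟩ := exists_max_neighbor _ c hex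
      simp only [Finset.mem_filter] at hd hmax
      obtain ⟨hd, hdb, hne⟩ := hd
      have hcd : c < d := hF _ hd
      have hr : r (l, b) < r (c, d) := by
        rcases hc with rfl | ⟨a, ha, har⟩
        · exact h _ he _ hd hne.symm (Or.inl ⟨le_rfl, hcd, hdb⟩)
        · refine har.trans (h _ ha _ hd (fun e => ?_) (Or.inr ⟨hF _ ha, le_rfl, hcd⟩))
          have := congrArg Prod.snd e
          simp only at this
          omega
      -- Arriving at `b` would close a cycle: `(c, b)` links to `(l, b)`, whose rank the walk has
      -- already exceeded.
      have hdb' : d ≠ b := by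
        rintro rfl
        have := h _ hd _ he hne (Or.inl ⟨hlc, hcb, le_rfl⟩)
        omega
      -- An edge passing over `d` would pass over `c`, or start at `c` and beat the choice of `d`,
      -- or cross `(c, d)`.
      obtain ⟨m, hm, hm', hm''⟩ := ih d (by omega) (by omega) (by omega) (by
        intro a d' ha hla had hdd hd'
        by_contra hcon
        rcases lt_trichotomy a c with hac | rfl | hac
        · exact hcon (hover a d' ha hla hac (by omega) hd')
        · have := hmax d' ⟨ha, hd', hcon⟩
          omega
        · exact h.not_crossing hd ha hac had hdd) (Or.inr ⟨c, hd, hr⟩)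
      exact ⟨m, by omega, hm', hm''⟩
    · refine ⟨c, le_rfl, hcb, fun a d ha hla hac hcd hd => ?_⟩
      rcases hac.lt_or_eq with hac | rfl
      · exact hover a d ha hla hac hcd hd
      · by_contra hcon
        exact hex ⟨d, by simp [ha, hd, hcon]⟩

theorem LinkMono.exists_gap {r : ℕ × ℕ → ℕ} {F : Finset (ℕ × ℕ)} (h : LinkMono r F)
    {l b : ℕ} (hF : ∀ x ∈ F, x.1 < x.2) (he : (l, b) ∈ F) :
    ∃ m, l ≤ m ∧ m < b ∧ ∀ a d, (a, d) ∈ F → l ≤ a → a ≤ m → m < d → d ≤ b → (a, d) = (l, b) :=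
  h.exists_gap_aux hF he (b - l) l le_rfl le_rfl (hF _ he) (fun _ _ _ _ _ => by omega)
    (Or.inl rfl)

namespace TernaryTree

/-- The noncrossing tree on the points `l, l + 1, …, l + size t` encoded by `t`. -/
def edges : TernaryTree → ℕ → Finset (ℕ × ℕ)
  | leaf, _ => ∅
  | node a b c, l =>
    insert (l, l + a.size + 1 + b.size)
      (a.edges l ∪ b.edges (l + a.size + 1) ∪ c.edges (l + a.size + 1 + b.size))

end TernaryTree

open TernaryTree

/-- A forest on `d + 1` points has at most `d` edges, with equality for trees. With `(l, b)` the
longest edge at `l` and a gap between `m` and `m + 1` below it, the remaining edges live on `[l,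
m]`, `[m + 1, b]` and `[b, l + d]`; these three pieces become the subtrees of the root. -/
theorem LinkMono.card_le {r : ℕ × ℕ → ℕ} (d : ℕ) {l : ℕ} {F : Finset (ℕ × ℕ)}
    (hF : EdgesIn l (l + d) F) (h : LinkMono r F) :
    F.card ≤ d ∧ (F.card = d → ∃ t : TernaryTree, t.size = d ∧ t.edges l = F) := by
  induction d using Nat.strong_induction_on generalizing l F with
  | _ d ih =>
  rcases Nat.eq_zero_or_pos d with rfl | hd
  · have : F = ∅ := by
      refine Finset.eq_empty_of_forall_notMem fun x hx => ?_
      have := hF x hx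
      omega
    subst this
    exact ⟨by simp, fun _ => ⟨leaf, rfl, rfl⟩⟩
  by_cases hex : ∃ b, (l, b) ∈ F
  swap
  -- With no edge at `l`, one point is wasted and the bound `d` is not attained.
  · have hF' : EdgesIn (l + 1) (l + 1 + (d - 1)) F := by
      rintro ⟨a, b⟩ hx
      obtain ⟨h1, h2, h3⟩ := hF _ hx
      have : a ≠ l := by rintro rfl; exact hex ⟨b, hx⟩
      simp only at *
      omega
    have := (ih (d - 1) (by omega) hF' h).1
    exact ⟨by omega, by omega⟩
  obtain ⟨b, hb, hmax⟩ := exists_max_neighbor F l hex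
  obtain ⟨m, hlm, hmb, hgap⟩ := h.exists_gap (fun x hx => (hF x hx).2.1) hb
  have hbd : b ≤ l + d := (hF _ hb).2.2
  set F₁ := F.filter fun x => x.2 ≤ m with hF₁
  set F₂ := F.filter fun x => m + 1 ≤ x.1 ∧ x.2 ≤ b with hF₂
  set F₃ := F.filter fun x => b ≤ x.1 with hF₃
  have hunion : F = insert (l, b) (F₁ ∪ F₂ ∪ F₃) := by
    ext ⟨a, c⟩
    simp only [hF₁, hF₂, hF₃, Finset.mem_insert, Finset.mem_union, Finset.mem_filter]
    constructor
    · intro hx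
      obtain ⟨h1, h2, h3⟩ := hF _ hx
      simp only at h1 h2 h3
      by_cases hba : b ≤ a
      · exact Or.inr (Or.inr ⟨hx, hba⟩)
      have hcb : c ≤ b := by
        by_contra hcon
        rcases h1.lt_or_eq with h1 | rfl
        · exact h.not_crossing hb hx h1 (by omega) (by omega)
        · exact hcon (hmax c hx)
      by_cases hma : m + 1 ≤ a
      · exact Or.inr (Or.inl (Or.inr ⟨hx, hma, hcb⟩))
      by_cases hcm : c ≤ m
      · exact Or.inr (Or.inl (Or.inl ⟨hx, hcm⟩))
      exact Or.inl (hgap a c hx h1 (by omega) (by omega) hcb)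
    · rintro (e | (h | h) | h)
      · rw [e]; exact hb
      all_goals exact h.1
  have h₁ := ih (m - l) (by omega) (l := l) (F := F₁) (by
    intro x hx
    obtain ⟨hx, hx'⟩ := Finset.mem_filter.1 hx
    have := hF x hx
    omega) (h.subset (Finset.filter_subset _ _))
  have h₂ := ih (b - (m + 1)) (by omega) (l := m + 1) (F := F₂) (by
    intro x hx
    obtain ⟨hx, hx'⟩ := Finset.mem_filter.1 hx
    have := hF x hx
    omega) (h.subset (Finset.filter_subset _ _))
  have h₃ := ih (l + d - b) (by omega) (l := b) (F := F₃) (by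
    intro x hx
    obtain ⟨hx, hx'⟩ := Finset.mem_filter.1 hx
    have := hF x hx
    omega) (h.subset (Finset.filter_subset _ _))
  -- The three bounds and the root add up to `(m - l) + (b - m - 1) + (l + d - b) + 1 = d`, so
  -- equality for `F` forces equality in each piece.
  have hcard : F.card ≤ F₁.card + F₂.card + F₃.card + 1 := by
    conv_lhs => rw [hunion]
    refine (Finset.card_insert_le _ _).trans ?_
    have := Finset.card_union_le (F₁ ∪ F₂) F₃
    have := Finset.card_union_le F₁ F₂
    omega
  obtain ⟨h₁, k₁⟩ := h₁
  obtain ⟨h₂, k₂⟩ := h₂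
  obtain ⟨h₃, k₃⟩ := h₃
  refine ⟨by clear k₁ k₂ k₃; omega, fun hd' => ?_⟩
  have hcards : F₁.card = m - l ∧ F₂.card = b - (m + 1) ∧ F₃.card = l + d - b := by
    clear k₁ k₂ k₃
    omega
  obtain ⟨t₁, hs₁, he₁⟩ := k₁ hcards.1
  obtain ⟨t₂, hs₂, he₂⟩ := k₂ hcards.2.1
  obtain ⟨t₃, hs₃, he₃⟩ := k₃ hcards.2.2
  clear k₁ k₂ k₃
  refine ⟨node t₁ t₂ t₃, by simp only [size]; omega, ?_⟩
  have e1 : l + (m - l) = m := by omega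
  have e2 : m + 1 + (b - (m + 1)) = b := by omega
  rw [hunion, edges, hs₁, hs₂, e1, e2, he₁, he₂, he₃]

/-! ### Noncrossing trees encoded by ternary trees -/

namespace TernaryTree

theorem edgesIn_edges (t : TernaryTree) (l : ℕ) : EdgesIn l (l + t.size) (t.edges l) := by
  induction t generalizing l with
  | leaf => intro x hx; simp [edges] at hx
  | node a b c iha ihb ihc =>
    intro x hx
    simp only [edges, Finset.mem_insert, Finset.mem_union] at hx
    simp only [size]
    rcases hx with rfl | (hx | hx) | hx
    · simp only; omega
    · have := iha _ x hx; omega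
    · have := ihb _ x hx; omega
    · have := ihc _ x hx; omega

/-- An ordering of the edges of a noncrossing tree with no links backwards. -/
def edgeList : TernaryTree → ℕ → List (ℕ × ℕ)
  | leaf, _ => []
  | node a b c, l =>
    b.edgeList (l + a.size + 1) ++ ((l, l + a.size + 1 + b.size) ::
      (a.edgeList l ++ c.edgeList (l + a.size + 1 + b.size)))

theorem toFinset_edgeList (t : TernaryTree) (l : ℕ) : (t.edgeList l).toFinset = t.edges l := by
  induction t generalizing l with
  | leaf => rfl
  | node a b c iha ihb ihc =>
    simp only [edgeList, edges, List.toFinset_append, List.toFinset_cons, iha, ihb, ihc]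
    ext x
    simp only [Finset.mem_insert, Finset.mem_union]
    tauto

theorem length_edgeList (t : TernaryTree) (l : ℕ) : (t.edgeList l).length = t.size := by
  induction t generalizing l with
  | leaf => rfl
  | node a b c iha ihb ihc =>
    simp only [edgeList, size, List.length_append, List.length_cons, iha, ihb, ihc]
    omega

theorem mem_edgeList {t : TernaryTree} {l : ℕ} {x : ℕ × ℕ} (hx : x ∈ t.edgeList l) :
    l ≤ x.1 ∧ x.1 < x.2 ∧ x.2 ≤ l + t.size :=
  edgesIn_edges t l x (by rwa [← toFinset_edgeList, List.mem_toFinset])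

/-- This dictates the order middle, root, left, right: middle edges ending at the right end of the
root link to it, the root links to left edges at its left end and to right edges at its right end,
and middle edges may link to right ones. The left piece touches neither of the other two. -/
theorem pairwise_edgeList (t : TernaryTree) (l : ℕ) :
    (t.edgeList l).Pairwise fun x y => ¬ Link y x := by
  induction t generalizing l with
  | leaf => exact List.Pairwise.nil
  | node a b c iha ihb ihc =>
    simp only [edgeList, List.pairwise_append, List.pairwise_cons, List.mem_cons, List.mem_append]
    refine ⟨ihb _, ⟨?_, iha _, ihc _, ?_⟩, ?_⟩
    · rintro y (hy | hy)
      all_goals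
        have := mem_edgeList hy
        simp only [Link]
        omega
    · intro x hx y hy
      have := mem_edgeList hx
      have := mem_edgeList hy
      simp only [Link]
      omega
    · rintro x hx y (rfl | hy | hy)
      · have := mem_edgeList hx
        simp only [Link]
        omega
      all_goals
        have := mem_edgeList hx
        have := mem_edgeList hy
        simp only [Link]
        omega

theorem exists_linkMono_edges (t : TernaryTree) (l : ℕ) : ∃ r, LinkMono r (t.edges l) := by
  refine ⟨fun x => (t.edgeList l).idxOf x, fun x hx y hy hne hxy => ?_⟩
  rw [← toFinset_edgeList, List.mem_toFinset] at hx hy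
  by_contra hcon
  have hlt : (t.edgeList l).idxOf y < (t.edgeList l).idxOf x := by
    refine lt_of_le_of_ne (not_lt.1 hcon) fun e => hne ?_
    exact ((List.idxOf_inj hy).1 e).symm
  have := List.pairwise_iff_getElem.1 (pairwise_edgeList t l) _ _ (List.idxOf_lt_length_of_mem hy)
    (List.idxOf_lt_length_of_mem hx) hlt
  simp only [List.getElem_idxOf] at this
  exact this hxy

theorem card_edges (t : TernaryTree) (l : ℕ) : (t.edges l).card = t.size := by
  rw [← toFinset_edgeList, List.toFinset_card_of_nodup, length_edgeList]
  -- Every edge links to itself, so the absence of backward links rules out repetitions.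
  refine List.Pairwise.imp_of_mem (fun hx _ h e => h ?_) (pairwise_edgeList t l)
  subst e
  have := mem_edgeList hx
  exact Or.inl ⟨le_rfl, this.2.1, le_rfl⟩

/-- Identifies the root inside the edge set, as the longest edge at `l`. -/
theorem snd_le_of_mem_edges_node {a b c : TernaryTree} {l d : ℕ}
    (h : (l, d) ∈ (node a b c).edges l) : d ≤ l + a.size + 1 + b.size := by
  simp only [edges, Finset.mem_insert, Finset.mem_union, Prod.mk.injEq] at h
  rcases h with h | (h | h) | h
  · omega
  all_goals
    have := edgesIn_edges _ _ _ h
    simp only at this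
    omega

theorem root_le_of_edges_node {a b c a' b' c' : TernaryTree} {l : ℕ}
    (h : (node a b c).edges l = (node a' b' c').edges l) :
    l + a.size + 1 + b.size ≤ l + a'.size + 1 + b'.size :=
  snd_le_of_mem_edges_node (c := c') (by rw [← h]; simp [edges])

/-- The gap below the root is determined. If `a'` were larger than `a`, its `a'.size` edges would be
those of `a` together with edges of `b` on the points `l + a.size + 1, …, l + a'.size`; by the
forest bound these are at most `a'.size - 1` edges. -/
theorem size_le_of_edges_node {a b c a' b' c' : TernaryTree} {l : ℕ}
    (h : (node a b c).edges l = (node a' b' c').edges l) : a'.size ≤ a.size := by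
  by_contra! hlt
  have h₁ := root_le_of_edges_node h
  have h₂ := root_le_of_edges_node h.symm
  obtain ⟨r, hr⟩ := exists_linkMono_edges b (l + a.size + 1)
  have hsub : a'.edges l ⊆ a.edges l ∪ (b.edges (l + a.size + 1)).filter
      fun x => x.2 ≤ l + a'.size := by
    intro x hx
    have hx' := edgesIn_edges _ _ x hx
    have hx'' : x ∈ (node a b c).edges l := by
      rw [h, edges]
      simp [hx]
    simp only [edges, Finset.mem_insert, Finset.mem_union] at hx''
    simp only [Finset.mem_union, Finset.mem_filter]
    rcases hx'' with rfl | (hx'' | hx'') | hx''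
    · simp only at hx'
      omega
    · exact Or.inl hx''
    · exact Or.inr ⟨hx'', hx'.2.2⟩
    · have := edgesIn_edges _ _ x hx''
      omega
  have hle := (LinkMono.card_le (a'.size - a.size - 1) (l := l + a.size + 1)
    (F := (b.edges (l + a.size + 1)).filter fun x => x.2 ≤ l + a'.size) (by
      intro x hx
      obtain ⟨hx, hx'⟩ := Finset.mem_filter.1 hx
      have := edgesIn_edges _ _ x hx
      omega) (hr.subset (Finset.filter_subset _ _))).1
  have := (Finset.card_le_card hsub).trans (Finset.card_union_le _ _)
  rw [card_edges, card_edges] at this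
  omega

/-- Once the sizes of the subtrees are known, position alone tells which edges belong to which
subtree; this and the next two lemmas drive `edges_injective`. -/
theorem edges_first (a b c : TernaryTree) (l : ℕ) :
    a.edges l = ((node a b c).edges l).filter fun x => x.2 ≤ l + a.size := by
  ext x
  simp only [edges, Finset.mem_insert, Finset.mem_union, Finset.mem_filter]
  constructor
  · intro hx
    exact ⟨by simp [hx], (edgesIn_edges _ _ x hx).2.2⟩
  · rintro ⟨rfl | (hx | hx) | hx, hx'⟩
    · simp only at hx'
      omega
    · exact hx
    all_goals
      have := edgesIn_edges _ _ x hx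
      omega

theorem edges_second (a b c : TernaryTree) (l : ℕ) :
    b.edges (l + a.size + 1) = ((node a b c).edges l).filter
      fun x => l + a.size + 1 ≤ x.1 ∧ x.2 ≤ l + a.size + 1 + b.size := by
  ext x
  simp only [edges, Finset.mem_insert, Finset.mem_union, Finset.mem_filter]
  constructor
  · intro hx
    have := edgesIn_edges _ _ x hx
    exact ⟨by simp [hx], this.1, this.2.2⟩
  · rintro ⟨rfl | (hx | hx) | hx, hx'⟩
    · simp only at hx'
      omega
    · have := edgesIn_edges _ _ x hx
      omega
    · exact hx
    · have := edgesIn_edges _ _ x hx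
      omega

theorem edges_third (a b c : TernaryTree) (l : ℕ) :
    c.edges (l + a.size + 1 + b.size) = ((node a b c).edges l).filter
      fun x => l + a.size + 1 + b.size ≤ x.1 := by
  ext x
  simp only [edges, Finset.mem_insert, Finset.mem_union, Finset.mem_filter]
  constructor
  · intro hx
    exact ⟨by simp [hx], (edgesIn_edges _ _ x hx).1⟩
  · rintro ⟨rfl | (hx | hx) | hx, hx'⟩
    · simp only at hx'
      omega
    · have := edgesIn_edges _ _ x hx
      omega
    · have := edgesIn_edges _ _ x hx
      omega
    · exact hx

theorem edges_injective (l : ℕ) : Function.Injective fun t : TernaryTree => t.edges l := by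
  intro t t' h
  induction t generalizing l t' with
  | leaf =>
    cases t' with
    | leaf => rfl
    | node a b c => exact absurd h.symm (Finset.insert_ne_empty _ _)
  | node a b c iha ihb ihc =>
    cases t' with
    | leaf => exact absurd h (Finset.insert_ne_empty _ _)
    | node a' b' c' =>
      replace h : (node a b c).edges l = (node a' b' c').edges l := h
      have ha : a.size = a'.size :=
        le_antisymm (size_le_of_edges_node h.symm) (size_le_of_edges_node h)
      have h₁ := root_le_of_edges_node h
      have h₂ := root_le_of_edges_node h.symm
      have hb : b.size = b'.size := by omega
      have e₁ : a.edges l = a'.edges l := by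
        rw [edges_first a b c, edges_first a' b' c', h, ha]
      have e₂ : b.edges (l + a.size + 1) = b'.edges (l + a.size + 1) := by
        rw [edges_second a b c, ha, edges_second a' b' c', h, hb]
      have e₃ : c.edges (l + a.size + 1 + b.size) = c'.edges (l + a.size + 1 + b.size) := by
        rw [edges_third a b c, ha, hb, edges_third a' b' c', h]
      rw [iha _ e₁, ihb _ e₂, ihc _ e₃]

end TernaryTree

/-! ### Counting orderable edge sets -/

/-- The sets of `n` edges on the points `0, …, n` which can be ordered without links backwards. -/
def linkOrderedSets (n : ℕ) : Set (Finset (ℕ × ℕ)) :=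
  {F | ∃ e : Fin n → ℕ × ℕ, (∀ i, (e i).1 < (e i).2 ∧ (e i).2 ≤ n) ∧
    (∀ i j, j < i → ¬ Link (e i) (e j)) ∧ F = Finset.univ.image e}

theorem linkOrderedSets_eq (n : ℕ) :
    linkOrderedSets n = (fun t : TernaryTree => t.edges 0) '' TernaryTree.ofSize n := by
  ext F
  constructor
  · rintro ⟨e, he, hlink, rfl⟩
    have hinj : Function.Injective e := by
      refine .of_lt_imp_ne fun i j hij h => hlink j i hij ?_
      rw [h]
      exact Or.inl ⟨le_rfl, (he j).1, le_rfl⟩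
    -- The rank of an edge is its position in the sequence; the value `0` off the image plays no
    -- role.
    have hr : LinkMono (fun x => if h : ∃ i, e i = x then (h.choose : ℕ) else 0)
        (Finset.univ.image e) := by
      intro x hx y hy hne hxy
      simp only [Finset.mem_image, Finset.mem_univ, true_and] at hx hy
      simp only [dif_pos hx, dif_pos hy]
      by_contra! hcon
      have hlt : hy.choose < hx.choose := by
        refine lt_of_le_of_ne hcon fun h => hne ?_
        rw [← hx.choose_spec, ← hy.choose_spec, h]
      apply hlink _ _ hlt
      rwa [hx.choose_spec, hy.choose_spec]
    obtain ⟨t, ht, ht'⟩ := (LinkMono.card_le n (l := 0) (by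
      intro x hx
      obtain ⟨i, -, rfl⟩ := Finset.mem_image.1 hx
      have := he i
      omega) hr).2 (by rw [Finset.card_image_of_injective _ hinj, Finset.card_fin])
    exact ⟨t, ht, ht'⟩
  · rintro ⟨t, rfl, rfl⟩
    have hlen := t.length_edgeList 0
    refine ⟨fun i => (t.edgeList 0)[(i : ℕ)]'(by omega), fun i => ?_, fun i j hij => ?_, ?_⟩
    · have := TernaryTree.mem_edgeList (List.getElem_mem (l := t.edgeList 0) (n := (i : ℕ))
        (by omega))
      simp only
      omega
    · exact List.pairwise_iff_getElem.1 (t.pairwise_edgeList 0) _ _ (by omega) (by omega) hij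
    · ext x
      simp only [Finset.mem_image, Finset.mem_univ, true_and]
      rw [← TernaryTree.toFinset_edgeList, List.mem_toFinset, List.mem_iff_getElem]
      constructor
      · rintro ⟨i, hi, rfl⟩
        exact ⟨⟨i, by omega⟩, rfl⟩
      · rintro ⟨i, rfl⟩
        exact ⟨i, by omega, rfl⟩

theorem linkOrderedSets_count (n : ℕ) :
    (linkOrderedSets n).Finite ∧
      (3 * n + 1 : ℚ) * ((linkOrderedSets n).ncard : ℚ) = (Nat.choose (3 * n + 1) n : ℚ) := by
  have h := TernaryTree.ofSize_count n
  rw [linkOrderedSets_eq, Set.ncard_image_of_injective _ (TernaryTree.edges_injective 0)]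
  exact ⟨h.1.image _, h.2⟩

/-! ### Morphisms of representations in linear components -/

section Pointwise

variable {k : Type u} [Field k] {J : Type} [Category.{0} J] {V W U : J ⥤ FGModuleCat.{u} k}

/-- The linear map by which a morphism acts in a representation. -/
def mapLin (V : J ⥤ FGModuleCat.{u} k) {i j : J} (p : i ⟶ j) : V.obj i →ₗ[k] V.obj j :=
  (V.map p).hom.hom

/-- The linear component of a morphism of representations. -/
def appLin (f : V ⟶ W) (i : J) : V.obj i →ₗ[k] W.obj i :=
  (f.app i).hom.hom

theorem mapLin_comp {i j l : J} (p : i ⟶ j) (q : j ⟶ l) (x : V.obj i) :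
    mapLin V q (mapLin V p x) = mapLin V (p ≫ q) x := by
  simp only [mapLin, V.map_comp]
  rfl

theorem mapLin_id {i : J} (x : V.obj i) : mapLin V (𝟙 i) x = x := by
  simp only [mapLin, V.map_id]
  rfl

theorem appLin_mapLin (f : V ⟶ W) {i j : J} (p : i ⟶ j) (x : V.obj i) :
    appLin f j (mapLin V p x) = mapLin W p (appLin f i x) := by
  have h := congrArg (fun g : V.obj i ⟶ W.obj j => g.hom.hom x) (f.naturality p)
  exact h

theorem appLin_comp (f : V ⟶ W) (g : W ⟶ U) (i : J) (x : V.obj i) :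
    appLin (f ≫ g) i x = appLin g i (appLin f i x) := rfl

theorem appLin_id (i : J) (x : V.obj i) : appLin (𝟙 V) i x = x := rfl

theorem appLin_zero (i : J) (x : V.obj i) : appLin (0 : V ⟶ W) i x = 0 := rfl

theorem rep_hom_ext {f g : V ⟶ W} (h : ∀ i x, appLin f i x = appLin g i x) : f = g := by
  ext i x
  exact h i x

/-- A morphism of representations from its linear components. -/
def homOfLin (f : ∀ i, V.obj i →ₗ[k] W.obj i)
    (h : ∀ i j (p : i ⟶ j) (x : V.obj i), f j (mapLin V p x) = mapLin W p (f i x)) : V ⟶ W where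
  app i := FGModuleCat.ofHom (f i)
  naturality i j p := by
    ext x
    exact h i j p x

theorem mono_of_appLin_injective (f : V ⟶ W) (h : ∀ i, Function.Injective (appLin f i)) :
    Mono f := by
  have : ∀ i, Mono (f.app i) := fun i => ConcreteCategory.mono_of_injective _ (h i)
  exact NatTrans.mono_of_mono_app f

theorem epi_of_appLin_surjective (f : V ⟶ W) (h : ∀ i, Function.Surjective (appLin f i)) :
    Epi f := by
  have : ∀ i, Epi (f.app i) := fun i => ConcreteCategory.epi_of_surjective _ (h i)
  exact NatTrans.epi_of_epi_app f

theorem appLin_surjective_of_epi (f : V ⟶ W) [Epi f] (i : J) : Function.Surjective (appLin f i) := by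
  have h : Epi (f.app i) := inferInstance
  have h' : Epi ((forget₂ (FGModuleCat.{u} k) (ModuleCat k)).map (f.app i)) := inferInstance
  exact (ModuleCat.epi_iff_surjective _).1 h'

end Pointwise

/-! ### Interval representations, their morphisms and resolutions -/

section StraightA

variable {k : Type u} [Field k] {n : ℕ}

/-- The number of a vertex of the straightly oriented quiver, counted from `0`. -/
def vertexNum (i : Paths (StraightA n)) : ℕ := Fin.val (n := n) i

theorem vertexNum_lt (i : Paths (StraightA n)) : vertexNum i < n := Fin.isLt (n := n) i

theorem vertexNum_injective : Function.Injective (vertexNum (n := n)) := Fin.val_injective (n := n)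

/-- The vertex with a given number. -/
def vertex (a : ℕ) (h : a < n) : Paths (StraightA n) := (⟨a, h⟩ : Fin n)

@[simp] theorem vertexNum_vertex (a : ℕ) (h : a < n) : vertexNum (vertex a h) = a := rfl

theorem vertexNum_le_of_path {i j : StraightA n} (p : Quiver.Path i j) :
    Fin.val (n := n) i ≤ Fin.val (n := n) j := by
  induction p with
  | nil => exact le_rfl
  | cons p e ih =>
    have := e.down
    omega

theorem vertexNum_le {i j : Paths (StraightA n)} (p : i ⟶ j) : vertexNum i ≤ vertexNum j :=
  vertexNum_le_of_path p

/-- Each arrow raises the number by one, so the last arrows of two parallel paths coincide. The path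
category is thus a linear order, and transition maps need not mention a path. -/
theorem path_subsingleton {i j : StraightA n} (p q : Quiver.Path i j) : p = q := by
  induction p with
  | nil =>
    cases q with
    | nil => rfl
    | cons q e =>
      have := vertexNum_le_of_path q
      have := e.down
      omega
  | cons p e ih =>
    cases q with
    | nil =>
      have := vertexNum_le_of_path p
      have := e.down
      omega
    | @cons c _ q e' =>
      rename_i b _
      have h : b = c := by
        refine Fin.ext (n := n) ?_
        have := e.down
        have := e'.down
        omega
      subst h
      rw [ih q, show e = e' from Subsingleton.elim (α := PLift _) e e']

instance (i j : Paths (StraightA n)) : Subsingleton (i ⟶ j) := ⟨path_subsingleton⟩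

theorem exists_path (i j : Paths (StraightA n)) (h : vertexNum i ≤ vertexNum j) :
    Nonempty (i ⟶ j) := by
  obtain ⟨d, hd⟩ := Nat.exists_eq_add_of_le h
  induction d generalizing j with
  | zero =>
    have : i = j := vertexNum_injective hd.symm
    subst this
    exact ⟨𝟙 i⟩
  | succ d ih =>
    have hj := vertexNum_lt j
    obtain ⟨p⟩ := ih (vertex (vertexNum i + d) (by omega)) (by simp) rfl
    refine ⟨Quiver.Path.cons p ⟨?_⟩⟩
    change vertexNum i + d + 1 = vertexNum j
    omega

open Classical in
/-- The transition map between two vertices of a representation, zero against the arrows. -/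
noncomputable def transition (V : QuiverRep k (StraightA n)) (i j : Paths (StraightA n)) :
    V.obj i →ₗ[k] V.obj j :=
  if h : Nonempty (i ⟶ j) then mapLin V h.some else 0

theorem transition_eq (V : QuiverRep k (StraightA n)) {i j : Paths (StraightA n)} (p : i ⟶ j) :
    transition V i j = mapLin V p := by
  have h : Nonempty (i ⟶ j) := ⟨p⟩
  rw [transition, dif_pos h, Subsingleton.elim h.some p]

theorem transition_self (V : QuiverRep k (StraightA n)) (i : Paths (StraightA n)) (x : V.obj i) :
    transition V i i x = x := by
  rw [transition_eq V (𝟙 i), mapLin_id]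

theorem mapLin_transition (V : QuiverRep k (StraightA n)) {i j l : Paths (StraightA n)}
    (h : vertexNum i ≤ vertexNum j) (p : j ⟶ l) (x : V.obj i) :
    mapLin V p (transition V i j x) = transition V i l x := by
  obtain ⟨q⟩ := exists_path i j h
  rw [transition_eq V q, transition_eq V (q ≫ p), mapLin_comp]

theorem transition_mapLin (V : QuiverRep k (StraightA n)) {i j l : Paths (StraightA n)}
    (p : i ⟶ j) (h : vertexNum j ≤ vertexNum l) (x : V.obj i) :
    transition V j l (mapLin V p x) = transition V i l x := by
  obtain ⟨q⟩ := exists_path j l h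
  rw [transition_eq V q, transition_eq V (p ≫ q), mapLin_comp]

theorem appLin_transition {V W : QuiverRep k (StraightA n)} (f : V ⟶ W)
    (i j : Paths (StraightA n)) (x : V.obj i) :
    appLin f j (transition V i j x) = transition W i j (appLin f i x) := by
  by_cases h : Nonempty (i ⟶ j)
  · rw [transition_eq V h.some, transition_eq W h.some, appLin_mapLin]
  · simp [transition, h]

variable (k) in
/-- The subspace of `k` which is all of `k` or zero, according to the proposition `P`. -/
def propSubspace (P : Prop) : Submodule k k where
  carrier := {x | ¬ P → x = 0}
  add_mem' hx hy h := by simp [hx h, hy h]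
  zero_mem' _ := rfl
  smul_mem' c x hx h := by simp [hx h]

/-- The map between subspaces of the line `k` that is the identity of `k` whenever possible. -/
def propSubspaceMap (P Q : Prop) [Decidable Q] : propSubspace k P →ₗ[k] propSubspace k Q where
  toFun x := ⟨if Q then x.1 else 0, fun h => if_neg h⟩
  map_add' x y := by
    ext
    by_cases h : Q <;> simp [h]
  map_smul' c x := by
    ext
    by_cases h : Q <;> simp [h]

variable (k n) in
/-- The interval representation, one-dimensional at the vertices with numbers in `[a, b)`. -/
noncomputable def interval (a b : ℕ) : QuiverRep k (StraightA n) where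
  obj i := FGModuleCat.of k (propSubspace k (a ≤ vertexNum i ∧ vertexNum i < b))
  map {i j} _ := FGModuleCat.ofHom (propSubspaceMap _ (a ≤ vertexNum j ∧ vertexNum j < b))
  map_id i := by
    ext x
    change (if a ≤ vertexNum i ∧ vertexNum i < b then x.1 else 0) = x.1
    split_ifs with h
    · rfl
    · exact (x.2 h).symm
  map_comp {i j l} p q := by
    ext x
    change (if a ≤ vertexNum l ∧ vertexNum l < b then x.1 else 0) =
      if a ≤ vertexNum l ∧ vertexNum l < b then
        (if a ≤ vertexNum j ∧ vertexNum j < b then x.1 else 0) else 0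
    split_ifs with h h'
    · rfl
    -- Convexity: if the interval contains `i` and `l`, it contains the intermediate vertex `j`.
    · refine x.2 fun hi => h' ?_
      have := vertexNum_le p
      have := vertexNum_le q
      omega
    · rfl

/-- The scalar underlying an element of an interval representation. -/
def scalar {a b : ℕ} {i : Paths (StraightA n)} : (interval k n a b).obj i →ₗ[k] k :=
  (propSubspace k (a ≤ vertexNum i ∧ vertexNum i < b)).subtype

theorem scalar_injective {a b : ℕ} {i : Paths (StraightA n)} :
    Function.Injective (scalar : (interval k n a b).obj i →ₗ[k] k) := Subtype.val_injective

theorem scalar_eq_zero {a b : ℕ} {i : Paths (StraightA n)} (x : (interval k n a b).obj i)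
    (h : ¬ (a ≤ vertexNum i ∧ vertexNum i < b)) : scalar x = 0 := x.2 h

theorem eq_zero_of_not_mem {a b : ℕ} {i : Paths (StraightA n)} (x : (interval k n a b).obj i)
    (h : ¬ (a ≤ vertexNum i ∧ vertexNum i < b)) : x = 0 :=
  scalar_injective (by rw [scalar_eq_zero x h, map_zero])

/-- The element of an interval representation with a given scalar. -/
def ofScalar {a b : ℕ} {i : Paths (StraightA n)} (c : k)
    (h : ¬ (a ≤ vertexNum i ∧ vertexNum i < b) → c = 0) : (interval k n a b).obj i :=
  (⟨c, h⟩ : propSubspace k (a ≤ vertexNum i ∧ vertexNum i < b))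

@[simp] theorem scalar_ofScalar {a b : ℕ} {i : Paths (StraightA n)} (c : k)
    (h : ¬ (a ≤ vertexNum i ∧ vertexNum i < b) → c = 0) :
    scalar (ofScalar c h : (interval k n a b).obj i) = c := rfl

theorem scalar_mapLin {a b : ℕ} {i j : Paths (StraightA n)} (p : i ⟶ j)
    (x : (interval k n a b).obj i) :
    scalar (mapLin (interval k n a b) p x) =
      if a ≤ vertexNum j ∧ vertexNum j < b then scalar x else 0 := rfl

theorem scalar_transition {a b : ℕ} {i j : Paths (StraightA n)} (h : vertexNum i ≤ vertexNum j)
    (x : (interval k n a b).obj i) :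
    scalar (transition (interval k n a b) i j x) =
      if a ≤ vertexNum j ∧ vertexNum j < b then scalar x else 0 := by
  obtain ⟨p⟩ := exists_path i j h
  rw [transition_eq _ p, scalar_mapLin]

/-- The morphism from an interval representation given by the image of a generator. -/
noncomputable def fromInterval {a b : ℕ} {V : QuiverRep k (StraightA n)}
    {i₀ : Paths (StraightA n)} (hi₀ : vertexNum i₀ = a) (v : V.obj i₀)
    (hv : ∀ j, b ≤ vertexNum j → transition V i₀ j v = 0) : interval k n a b ⟶ V :=
  homOfLin (fun i => scalar.smulRight (transition V i₀ i v)) (by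
    intro i j p x
    simp only [LinearMap.smulRight_apply, map_smul, scalar_mapLin]
    by_cases hi : a ≤ vertexNum i ∧ vertexNum i < b
    · rw [mapLin_transition V (by omega) p]
      split_ifs with hj
      · rfl
      · have := vertexNum_le p
        rw [hv j (by omega), smul_zero, smul_zero]
    · rw [scalar_eq_zero x hi]
      simp)

theorem appLin_fromInterval {a b : ℕ} {V : QuiverRep k (StraightA n)}
    {i₀ : Paths (StraightA n)} (hi₀ : vertexNum i₀ = a) (v : V.obj i₀)
    (hv : ∀ j, b ≤ vertexNum j → transition V i₀ j v = 0) (i : Paths (StraightA n))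
    (x : (interval k n a b).obj i) :
    appLin (fromInterval hi₀ v hv) i x = scalar x • transition V i₀ i v := rfl

/-- The generator of an interval representation. -/
def gen {a b : ℕ} {i₀ : Paths (StraightA n)} (hi₀ : vertexNum i₀ = a) (hab : a < b) :
    (interval k n a b).obj i₀ :=
  ofScalar 1 fun h => absurd ⟨hi₀.ge, by omega⟩ h

/-- Every element of an interval is a multiple of a transported generator. Together with
`fromInterval`, this identifies morphisms from `[a, b)` to `V` with the vectors at `a` that die from
`b` on. -/
theorem appLin_eq_smul {a b : ℕ} {V : QuiverRep k (StraightA n)} (f : interval k n a b ⟶ V)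
    {i₀ : Paths (StraightA n)} (hi₀ : vertexNum i₀ = a) (hab : a < b) (i : Paths (StraightA n))
    (x : (interval k n a b).obj i) :
    appLin f i x = scalar x • transition V i₀ i (appLin f i₀ (gen hi₀ hab)) := by
  by_cases hi : a ≤ vertexNum i ∧ vertexNum i < b
  · rw [← appLin_transition, ← map_smul]
    congr 1
    apply scalar_injective
    rw [map_smul, scalar_transition (by omega), if_pos hi]
    simp [gen]
  · rw [eq_zero_of_not_mem x hi]
    simp

theorem interval_hom_ext {a b : ℕ} {V : QuiverRep k (StraightA n)} {f g : interval k n a b ⟶ V}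
    {i₀ : Paths (StraightA n)} (hi₀ : vertexNum i₀ = a) (hab : a < b)
    (h : appLin f i₀ (gen hi₀ hab) = appLin g i₀ (gen hi₀ hab)) : f = g :=
  rep_hom_ext fun i x => by rw [appLin_eq_smul f hi₀ hab, appLin_eq_smul g hi₀ hab, h]

theorem appLin_fromInterval_gen {a b : ℕ} {V : QuiverRep k (StraightA n)}
    {i₀ : Paths (StraightA n)} (hi₀ : vertexNum i₀ = a) (hab : a < b) (v : V.obj i₀)
    (hv : ∀ j, b ≤ vertexNum j → transition V i₀ j v = 0) :
    appLin (fromInterval hi₀ v hv) i₀ (gen hi₀ hab) = v := by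
  rw [appLin_fromInterval, transition_self]
  simp [gen]

theorem interval_hom_eq_zero {a b c d : ℕ} (hab : a < b) (hbn : b ≤ n) (hdn : d ≤ n)
    (h : ¬ (c ≤ a ∧ a < d ∧ d ≤ b)) (f : interval k n a b ⟶ interval k n c d) : f = 0 := by
  have hi₀ : vertexNum (vertex (n := n) a (by omega)) = a := rfl
  apply interval_hom_ext hi₀ hab
  rw [appLin_zero]
  by_cases had : c ≤ a ∧ a < d
  -- Here `b < d`: the generator dies at vertex `b`, while its image in `[c, d)` would survive
  -- there.
  · have hb : vertexNum (vertex (n := n) b (by omega)) = b := rfl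
    have h₁ := appLin_transition f _ (vertex b (by omega)) (gen hi₀ hab)
    rw [eq_zero_of_not_mem (transition (interval k n a b) _ _ _) (by omega), map_zero] at h₁
    have h₂ := congrArg scalar h₁
    rw [map_zero, scalar_transition (by omega), if_pos (by omega)] at h₂
    exact scalar_injective (by rw [← h₂, map_zero])
  · exact eq_zero_of_not_mem _ had

theorem exists_interval_hom_ne_zero {a b c d : ℕ} (hab : a < b) (hbn : b ≤ n)
    (hca : c ≤ a) (had : a < d) (hdb : d ≤ b) :
    ∃ f : interval k n a b ⟶ interval k n c d, f ≠ 0 := by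
  have hi₀ : vertexNum (vertex (n := n) a (by omega)) = a := rfl
  refine ⟨fromInterval hi₀ (ofScalar 1 fun h => absurd ⟨hca, had⟩ h)
    fun j hj => eq_zero_of_not_mem _ (by omega), fun h => ?_⟩
  have h₁ := congrArg (fun f => scalar (appLin f _ (gen hi₀ hab))) h
  simp only [appLin_fromInterval_gen, appLin_zero, scalar_ofScalar, map_zero] at h₁
  exact one_ne_zero h₁

theorem interval_end_eq_smul {a b : ℕ} (hab : a < b) (hbn : b ≤ n)
    (f : interval k n a b ⟶ interval k n a b) : ∃ c : k, ∀ i x, appLin f i x = c • x := by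
  have hi₀ : vertexNum (vertex (n := n) a (by omega)) = a := rfl
  refine ⟨scalar (appLin f _ (gen hi₀ hab)), fun i x => ?_⟩
  rw [appLin_eq_smul f hi₀ hab]
  by_cases hi : a ≤ vertexNum i ∧ vertexNum i < b
  · apply scalar_injective
    rw [map_smul, map_smul, scalar_transition (by omega), if_pos hi, smul_eq_mul, smul_eq_mul,
      mul_comm]
  · rw [eq_zero_of_not_mem x hi]
    simp

theorem interval_isUnit {a b : ℕ} (hab : a < b) (hbn : b ≤ n) (f : End (interval k n a b))
    (hf : f ≠ 0) : IsUnit f := by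
  obtain ⟨c, hc⟩ := interval_end_eq_smul hab hbn f
  have hc0 : c ≠ 0 := by
    rintro rfl
    exact hf (rep_hom_ext fun i x => by rw [hc, zero_smul]; rfl)
  let g : End (interval k n a b) := homOfLin (fun i => c⁻¹ • LinearMap.id)
    (by intro i j p x; simp)
  have hg : ∀ i x, appLin g i x = c⁻¹ • x := fun _ _ => rfl
  refine ⟨⟨f, g, ?_, ?_⟩, rfl⟩
  · refine rep_hom_ext fun i x => ?_
    change appLin (g ≫ f) i x = x
    rw [appLin_comp, hc, hg, smul_smul, mul_inv_cancel₀ hc0, one_smul]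
  · refine rep_hom_ext fun i x => ?_
    change appLin (f ≫ g) i x = x
    rw [appLin_comp, hc, hg, smul_smul, inv_mul_cancel₀ hc0, one_smul]

theorem interval_nontrivial {a b : ℕ} (hab : a < b) (hbn : b ≤ n) :
    Nontrivial (End (interval k n a b)) := by
  obtain ⟨f, hf⟩ := exists_interval_hom_ne_zero (k := k) hab hbn le_rfl hab le_rfl
  exact ⟨⟨f, 0, hf⟩⟩

/-- No vertex lies beyond `n - 1`, so morphisms out of `[a, n)` are arbitrary vectors at `a`, and
vectors lift along surjections. -/
theorem interval_projective {a : ℕ} (han : a < n) : Projective (interval k n a n) where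
  factors {V W} f e he := by
    have hi₀ : vertexNum (vertex (n := n) a han) = a := rfl
    obtain ⟨v, hv⟩ := appLin_surjective_of_epi e _ (appLin f _ (gen hi₀ han))
    refine ⟨fromInterval hi₀ v fun j hj => absurd (vertexNum_lt j) (by omega), ?_⟩
    apply interval_hom_ext hi₀ han
    rw [appLin_comp, appLin_fromInterval_gen, hv]

/-- The inclusion of an indecomposable projective representation into a larger one. -/
noncomputable def intervalIncl (k : Type u) [Field k] {n a b : ℕ} (hab : a < b) (hbn : b < n) :
    interval k n b n ⟶ interval k n a n :=
  fromInterval (vertexNum_vertex b hbn) (ofScalar 1 fun h => absurd ⟨hab.le, hbn⟩ h)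
    fun j hj => absurd (vertexNum_lt j) (by omega)

/-- The projection of an indecomposable projective representation onto an interval. -/
noncomputable def intervalProj (k : Type u) [Field k] {n a b : ℕ} (hab : a < b) (hbn : b < n) :
    interval k n a n ⟶ interval k n a b :=
  fromInterval (vertexNum_vertex a (hab.trans hbn)) (gen (vertexNum_vertex a (hab.trans hbn)) hab)
    fun j hj => absurd (vertexNum_lt j) (by omega)

theorem scalar_intervalIncl {a b : ℕ} (hab : a < b) (hbn : b < n) (i : Paths (StraightA n))
    (x : (interval k n b n).obj i) : scalar (appLin (intervalIncl k hab hbn) i x) = scalar x := by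
  rw [intervalIncl, appLin_fromInterval]
  by_cases hi : b ≤ vertexNum i ∧ vertexNum i < n
  · rw [map_smul, scalar_transition (by simpa using hi.1), if_pos (by omega), scalar_ofScalar,
      smul_eq_mul, mul_one]
  · rw [scalar_eq_zero x hi, zero_smul, map_zero]

theorem scalar_intervalProj {a b : ℕ} (hab : a < b) (hbn : b < n) (i : Paths (StraightA n))
    (x : (interval k n a n).obj i) : scalar (appLin (intervalProj k hab hbn) i x) =
      if a ≤ vertexNum i ∧ vertexNum i < b then scalar x else 0 := by
  rw [intervalProj, appLin_fromInterval]
  by_cases hi : a ≤ vertexNum i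
  · rw [map_smul, scalar_transition (by simpa using hi)]
    split_ifs
    · simp [gen]
    · simp
  · rw [scalar_eq_zero x (by omega), if_neg (by omega), zero_smul, map_zero]

/-- The condition for a morphism to factor through the projection onto an interval. -/
theorem appLin_gen_transition_eq_zero {a b : ℕ} (hab : a < b) (hbn : b < n)
    {V : QuiverRep k (StraightA n)} (f : interval k n a n ⟶ V) (hf : intervalIncl k hab hbn ≫ f = 0)
    (j : Paths (StraightA n)) (hj : b ≤ vertexNum j) :
    transition V (vertex a (hab.trans hbn)) j (appLin f _ (gen (vertexNum_vertex a (hab.trans hbn)) (hab.trans hbn))) = 0 := by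
  rw [← appLin_transition]
  have hjn := vertexNum_lt j
  have h : transition (interval k n a n) _ j (gen (vertexNum_vertex a (hab.trans hbn))
      (hab.trans hbn)) = appLin (intervalIncl k hab hbn) j
        (ofScalar 1 fun h => absurd ⟨hj, vertexNum_lt j⟩ h) := by
    apply scalar_injective
    rw [scalar_intervalIncl, scalar_transition (by simp; omega), if_pos (by omega)]
    simp [gen]
  rw [h, ← appLin_comp, hf, appLin_zero]

theorem intervalIncl_comp_intervalProj {a b : ℕ} (hab : a < b) (hbn : b < n) :
    intervalIncl k hab hbn ≫ intervalProj k hab hbn = 0 := by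
  refine rep_hom_ext fun i x => scalar_injective ?_
  rw [appLin_comp, scalar_intervalProj, scalar_intervalIncl, appLin_zero, map_zero]
  split_ifs with h
  · exact scalar_eq_zero x (by omega)
  · rfl

/-- The projective resolution of an interval representation. -/
noncomputable def intervalSequence (k : Type u) [Field k] {n a b : ℕ} (hab : a < b) (hbn : b < n) :
    ShortComplex (QuiverRep k (StraightA n)) :=
  ShortComplex.mk _ _ (intervalIncl_comp_intervalProj (k := k) hab hbn)

theorem intervalSequence_shortExact {a b : ℕ} (hab : a < b) (hbn : b < n) :
    (intervalSequence k hab hbn).ShortExact := by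
  have hmono : Mono (intervalIncl k hab hbn) := mono_of_appLin_injective _ fun i x y h =>
    scalar_injective <| by
      rw [← scalar_intervalIncl hab hbn, h, scalar_intervalIncl]
  have : Mono (intervalSequence k hab hbn).f := hmono
  have hepi : Epi (intervalProj k hab hbn) := epi_of_appLin_surjective _ fun i x => by
    refine ⟨ofScalar (scalar x) fun h => scalar_eq_zero x (by omega), scalar_injective ?_⟩
    rw [scalar_intervalProj, scalar_ofScalar]
    split_ifs with h
    · rfl
    · exact (scalar_eq_zero x h).symm
  have : Epi (intervalSequence k hab hbn).g := hepi
  refine ShortComplex.ShortExact.mk (ShortComplex.exact_of_g_is_cokernel _ ?_)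
  -- A morphism from `[a, n)` that kills `[b, n)` sends the generator to a vector dying from `b` on,
  -- which is what a morphism from `[a, b)` amounts to.
  refine Limits.CokernelCofork.IsColimit.ofπ' (hp := hepi) (intervalProj k hab hbn)
    (intervalIncl_comp_intervalProj (k := k) hab hbn) fun f hf =>
    ⟨fromInterval (vertexNum_vertex a (hab.trans hbn)) _
      (appLin_gen_transition_eq_zero hab hbn f hf), ?_⟩
  apply interval_hom_ext (vertexNum_vertex a (hab.trans hbn)) (hab.trans hbn)
  rw [appLin_comp, intervalProj, appLin_fromInterval_gen, appLin_fromInterval_gen]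

end StraightA

/-! ### Ext from a short projective resolution -/

section Ext

universe w v u'

variable {C : Type u'} [Category.{v} C] [Abelian C] [HasExt.{w} C]

open Abelian

/-- Since `Ext^1(X₂, Y) = 0`, the long exact sequence makes `Ext^1(X₃, Y)` the cokernel of `Hom(X₂,
Y) → Hom(X₁, Y)`. -/
theorem ext_one_subsingleton_iff {S : ShortComplex C} (hS : S.ShortExact) [Projective S.X₂] (Y : C) :
    Subsingleton (Ext S.X₃ Y 1) ↔ ∀ f : S.X₁ ⟶ Y, ∃ g : S.X₂ ⟶ Y, S.f ≫ g = f := by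
  constructor
  · intro h f
    obtain ⟨x, hx⟩ := Ext.contravariant_sequence_exact₁ hS Y (Ext.mk₀ f) (add_zero 1)
      (Subsingleton.elim _ _)
    obtain ⟨g, rfl⟩ := (Ext.mk₀_bijective _ _).2 x
    refine ⟨g, (Ext.mk₀_bijective _ _).1 ?_⟩
    rw [← hx, Ext.mk₀_comp_mk₀]
  · intro h
    refine subsingleton_of_forall_eq 0 fun x => ?_
    obtain ⟨y, rfl⟩ := Ext.contravariant_sequence_exact₃ hS Y x (Ext.eq_zero_of_projective _)
      (add_zero 1)
    obtain ⟨f, rfl⟩ := (Ext.mk₀_bijective _ _).2 y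
    obtain ⟨g, rfl⟩ := h f
    rw [← Ext.mk₀_comp_mk₀, ShortComplex.ShortExact.extClass_comp_assoc]

/-- Dimension shift: every class in degree `m + 2` comes from `Ext^(m+1)(X₁, Y) = 0`. -/
theorem ext_subsingleton_of_resolution {S : ShortComplex C} (hS : S.ShortExact) [Projective S.X₁]
    [Projective S.X₂] (Y : C) (m : ℕ) : Subsingleton (Ext S.X₃ Y (m + 2)) := by
  refine subsingleton_of_forall_eq 0 fun x => ?_
  obtain ⟨y, rfl⟩ := Ext.contravariant_sequence_exact₃ hS Y x (Ext.eq_zero_of_projective _)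
    (show 1 + (m + 1) = m + 2 by omega)
  rw [Ext.eq_zero_of_projective y, Ext.comp_zero]

theorem ext_subsingleton_of_iso {X X' Y Y' : C} (e : X ≅ X') (e' : Y ≅ Y') (m : ℕ)
    (h : Subsingleton (Ext X Y m)) : Subsingleton (Ext X' Y' m) := by
  refine subsingleton_of_forall_eq 0 fun x => ?_
  have h₁ : ((Ext.mk₀ e.hom).comp x (zero_add m)).comp (Ext.mk₀ e'.inv) (add_zero m) = 0 :=
    Subsingleton.elim _ _
  have h₂ := congrArg (fun z => ((Ext.mk₀ e.inv).comp z (zero_add m)).comp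
    (Ext.mk₀ e'.hom) (add_zero m)) h₁
  simpa using h₂

end Ext

/-! ### Exceptional representations as intervals, exceptional sequences as orderings -/

section StraightA

variable {k : Type u} [Field k] {n : ℕ}

/-- For `b = n` the first interval is projective. Otherwise the question is whether morphisms `[b,
n) ⟶ [c, d)` extend to `[a, n)`: nonzero ones exist only for `c ≤ b < d`, and they extend exactly
when `[c, d)` already contains `a`. -/
theorem interval_extVanishes_one_iff {a b c d : ℕ} (hab : a < b) (hbn : b ≤ n) (hdn : d ≤ n) :
    ExtVanishes (interval k n a b) (interval k n c d) 1 ↔ ¬ (a < c ∧ c ≤ b ∧ b < d) := by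
  let : HasExt (QuiverRep k (StraightA n)) := HasExt.standard _
  change Subsingleton (Abelian.Ext (interval k n a b) (interval k n c d) 1) ↔ _
  rcases hbn.lt_or_eq with hbn | rfl
  swap
  · have := interval_projective (k := k) hab
    exact ⟨fun _ h => by omega, fun _ => Abelian.Ext.subsingleton_of_projective _ _ 0⟩
  have : Projective (intervalSequence k hab hbn).X₂ := interval_projective (k := k) (hab.trans hbn)
  rw [show interval k n a b = (intervalSequence k hab hbn).X₃ from rfl,
    ext_one_subsingleton_iff (intervalSequence_shortExact hab hbn)]
  change (∀ f : interval k n b n ⟶ interval k n c d, ∃ g : interval k n a n ⟶ interval k n c d,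
    intervalIncl k hab hbn ≫ g = f) ↔ _
  constructor
  · rintro h ⟨h₁, h₂, h₃⟩
    obtain ⟨f, hf⟩ := exists_interval_hom_ne_zero (k := k) (n := n) hbn le_rfl h₂ h₃ hdn
    obtain ⟨g, rfl⟩ := h f
    apply hf
    rw [interval_hom_eq_zero (by omega) le_rfl hdn (by omega) g, Limits.comp_zero]
  · intro h f
    by_cases hb : c ≤ b ∧ b < d
    swap
    · refine ⟨0, ?_⟩
      rw [interval_hom_eq_zero hbn le_rfl hdn (by omega) f, Limits.comp_zero]
    -- Now `c ≤ a`, so `[c, d)` contains both `a` and `b`; the scalar at `b` is placed at `a`, and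
    -- the transition carries it back unchanged.
    refine ⟨fromInterval (vertexNum_vertex a (hab.trans hbn))
      (ofScalar (scalar (appLin f _ (gen (vertexNum_vertex b hbn) hbn))) fun h' => ?_)
      fun j hj => absurd (vertexNum_lt j) (by omega), ?_⟩
    · rw [vertexNum_vertex] at h'
      omega
    · apply interval_hom_ext (vertexNum_vertex b hbn) hbn
      apply scalar_injective
      rw [appLin_comp, appLin_fromInterval, scalar_intervalIncl, map_smul, scalar_transition
        (by simpa using hab.le), if_pos (by simpa using hb), scalar_ofScalar]
      simp [gen]

theorem interval_extVanishes_add_two {a b : ℕ} (hab : a < b) (hbn : b ≤ n)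
    (W : QuiverRep k (StraightA n)) (m : ℕ) : ExtVanishes (interval k n a b) W (m + 2) := by
  let : HasExt (QuiverRep k (StraightA n)) := HasExt.standard _
  change Subsingleton (Abelian.Ext (interval k n a b) W (m + 2))
  rcases hbn.lt_or_eq with hbn | rfl
  · have : Projective (intervalSequence k hab hbn).X₁ := interval_projective (k := k) hbn
    have : Projective (intervalSequence k hab hbn).X₂ :=
      interval_projective (k := k) (hab.trans hbn)
    exact ext_subsingleton_of_resolution (intervalSequence_shortExact hab hbn) W m
  · have := interval_projective (k := k) hab
    exact Abelian.Ext.subsingleton_of_projective _ _ (m + 1)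

theorem ExtVanishes.of_iso {V V' W W' : QuiverRep k (StraightA n)} {m : ℕ}
    (h : ExtVanishes V W m) (e : V ≅ V') (e' : W ≅ W') : ExtVanishes V' W' m := by
  let : HasExt (QuiverRep k (StraightA n)) := HasExt.standard _
  exact ext_subsingleton_of_iso e e' m h

theorem interval_isExceptional {a b : ℕ} (hab : a < b) (hbn : b ≤ n) :
    IsExceptional (interval k n a b) where
  nontrivial_end := interval_nontrivial hab hbn
  isUnit_of_ne_zero := interval_isUnit hab hbn
  ext_self i hi := by
    match i, hi with
    | 1, _ => exact (interval_extVanishes_one_iff hab hbn hbn).2 (by omega)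
    | m + 2, _ => exact interval_extVanishes_add_two hab hbn _ m

theorem interval_link_iff {x y : ℕ × ℕ} (hx : x.1 < x.2 ∧ x.2 ≤ n) (hy : y.1 < y.2 ∧ y.2 ≤ n) :
    ¬ Link x y ↔ (∀ f : interval k n x.1 x.2 ⟶ interval k n y.1 y.2, f = 0) ∧
      ExtVanishes (interval k n x.1 x.2) (interval k n y.1 y.2) 1 := by
  rw [interval_extVanishes_one_iff hx.1 hx.2 hy.2, Link, not_or]
  refine and_congr_left fun _ => ⟨fun h f => interval_hom_eq_zero hx.1 hx.2 hy.2 h f,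
    fun h h' => ?_⟩
  obtain ⟨f, hf⟩ := exists_interval_hom_ne_zero (k := k) hx.1 hx.2 h'.1 h'.2.1 h'.2.2
  exact hf (h f)

theorem interval_eq_of_iso {x y : ℕ × ℕ} (hx : x.1 < x.2 ∧ x.2 ≤ n) (hy : y.1 < y.2 ∧ y.2 ≤ n)
    (e : interval k n x.1 x.2 ≅ interval k n y.1 y.2) : x = y := by
  obtain ⟨f, hf⟩ := exists_interval_hom_ne_zero (k := k) hx.1 hx.2 le_rfl hx.1 le_rfl
  have h₁ : y.1 ≤ x.1 ∧ x.1 < y.2 ∧ y.2 ≤ x.2 := by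
    by_contra h
    apply hf
    rw [← cancel_mono e.hom, interval_hom_eq_zero hx.1 hx.2 hy.2 h (f ≫ e.hom), Limits.zero_comp]
  have h₂ : x.1 ≤ y.1 ∧ y.1 < x.2 ∧ x.2 ≤ y.2 := by
    by_contra h
    apply hf
    rw [← cancel_epi e.inv, interval_hom_eq_zero hy.1 hy.2 hx.2 h (e.inv ≫ f), Limits.comp_zero]
  exact Prod.ext (by omega) (by omega)

/-- The morphism to an interval representation given by a linear form at its last vertex. -/
noncomputable def toInterval {a b : ℕ} {V : QuiverRep k (StraightA n)} {j₀ : Paths (StraightA n)}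
    (hj₀ : vertexNum j₀ + 1 = b) (φ : V.obj j₀ →ₗ[k] k)
    (hV : ∀ i, vertexNum i < a → Subsingleton (V.obj i)) : V ⟶ interval k n a b :=
  homOfLin (fun i =>
    (show V.obj i →ₗ[k] propSubspace k (a ≤ vertexNum i ∧ vertexNum i < b) from
      LinearMap.codRestrict _
        (if a ≤ vertexNum i ∧ vertexNum i < b then φ ∘ₗ transition V i j₀ else 0)
        (fun x h => by rw [if_neg h, LinearMap.zero_apply]))) (by
    intro i j p x
    apply scalar_injective
    rw [scalar_mapLin]
    change (if a ≤ vertexNum j ∧ vertexNum j < b then φ ∘ₗ transition V j j₀ else 0)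
      (mapLin V p x) = if a ≤ vertexNum j ∧ vertexNum j < b then
        (if a ≤ vertexNum i ∧ vertexNum i < b then φ ∘ₗ transition V i j₀ else 0) x else 0
    have hij := vertexNum_le p
    by_cases hi : vertexNum i < a
    · have := hV i hi
      rw [Subsingleton.elim x 0]
      simp
    · split_ifs with h₁ h₂
      · rw [LinearMap.comp_apply, LinearMap.comp_apply, transition_mapLin V p (by omega)]
      · omega
      · rfl)

theorem scalar_toInterval {a b : ℕ} {V : QuiverRep k (StraightA n)} {j₀ : Paths (StraightA n)}
    (hj₀ : vertexNum j₀ + 1 = b) (φ : V.obj j₀ →ₗ[k] k)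
    (hV : ∀ i, vertexNum i < a → Subsingleton (V.obj i)) (i : Paths (StraightA n))
    (hi : a ≤ vertexNum i ∧ vertexNum i < b) (x : V.obj i) :
    scalar (appLin (toInterval hj₀ φ hV) i x) = φ (transition V i j₀ x) := by
  change (if a ≤ vertexNum i ∧ vertexNum i < b then φ ∘ₗ transition V i j₀ else 0) x = _
  rw [if_pos hi]
  rfl

/-- Let `a` be the first vertex where `V` is nonzero and `m` the last one to which the transition
from `a` is nonzero. A vector `v` at `a` with nonzero image at `m` spans a copy of `[a, m + 1)`; a
linear form at `m` taking the value `1` on that image gives the retraction, a morphism because `V`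
vanishes before `a`. -/
theorem exists_interval_retract (V : QuiverRep k (StraightA n)) (hV : Nontrivial (End V)) :
    ∃ a b : ℕ, a < b ∧ b ≤ n ∧ ∃ (f : interval k n a b ⟶ V) (g : V ⟶ interval k n a b),
      f ≫ g = 𝟙 _ := by
  have hne : ∃ a, ∃ i : Paths (StraightA n), vertexNum i = a ∧ Nontrivial (V.obj i) := by
    by_contra! hcon
    obtain ⟨f, g, hfg⟩ := hV
    refine hfg (rep_hom_ext fun i x => ?_)
    have := hcon _ i rfl
    exact Subsingleton.elim _ _
  classical
  obtain ⟨i₀, hi₀, hnt⟩ := Nat.find_spec hne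
  have hmin : ∀ i, vertexNum i < Nat.find hne → Subsingleton (V.obj i) := fun i hi =>
    not_nontrivial_iff_subsingleton.1 fun h => Nat.find_min hne hi ⟨i, rfl, h⟩
  generalize Nat.find hne = a at hi₀ hmin
  let T : Finset ℕ := (Finset.range n).filter
    fun m => ∃ j : Paths (StraightA n), vertexNum j = m ∧ transition V i₀ j ≠ 0
  have hT : T.Nonempty := by
    refine ⟨vertexNum i₀, ?_⟩
    simp only [T, Finset.mem_filter, Finset.mem_range]
    refine ⟨vertexNum_lt i₀, i₀, rfl, fun h => ?_⟩
    obtain ⟨v, hv⟩ := exists_ne (0 : V.obj i₀)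
    apply hv
    rw [← transition_self V i₀ v, h, LinearMap.zero_apply]
  obtain ⟨m, hm, hmax⟩ := T.exists_max_image id hT
  simp only [T, Finset.mem_filter, Finset.mem_range, id] at hm hmax
  obtain ⟨hmn, j₀, hj₀, hne₀⟩ := hm
  obtain ⟨v, hv⟩ : ∃ v, transition V i₀ j₀ v ≠ 0 := by
    by_contra! h
    exact hne₀ (LinearMap.ext h)
  obtain ⟨φ, hφ⟩ : ∃ φ : V.obj j₀ →ₗ[k] k, φ (transition V i₀ j₀ v) ≠ 0 := by
    by_contra! h
    exact hv ((Module.forall_dual_apply_eq_zero_iff k _).1 h)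
  have ham : a ≤ m := by
    by_contra! h
    have := hmin j₀ (by omega)
    exact hv (Subsingleton.elim _ _)
  have hkill : ∀ j, m + 1 ≤ vertexNum j → transition V i₀ j v = 0 := fun j hj => by
    by_contra h
    have := hmax (vertexNum j) ⟨vertexNum_lt j, j, rfl, fun h' => h (by rw [h']; rfl)⟩
    omega
  refine ⟨a, m + 1, by omega, hmn, fromInterval hi₀ v hkill,
    toInterval (by rw [hj₀]) ((φ (transition V i₀ j₀ v))⁻¹ • φ) hmin, ?_⟩
  apply interval_hom_ext hi₀ (by omega)
  apply scalar_injective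
  rw [appLin_comp, appLin_fromInterval_gen, scalar_toInterval _ _ _ _ (by omega), appLin_id]
  simp [gen, hφ]

/-- The retract yields a nonzero idempotent endomorphism of `V`; being a unit it is the identity, so
no decomposition theorem is needed. -/
theorem IsExceptional.exists_iso_interval {V : QuiverRep k (StraightA n)} (hV : IsExceptional V) :
    ∃ x : ℕ × ℕ, (x.1 < x.2 ∧ x.2 ≤ n) ∧ Nonempty (V ≅ interval k n x.1 x.2) := by
  obtain ⟨a, b, hab, hbn, f, g, hfg⟩ := exists_interval_retract V hV.nontrivial_end
  refine ⟨(a, b), ⟨hab, hbn⟩, ⟨⟨g, f, ?_, hfg⟩⟩⟩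
  let e : End V := g ≫ f
  have he : e ≠ 0 := by
    intro h
    have h₁ : f ≫ (g ≫ f) ≫ g = 𝟙 _ := by
      rw [Category.assoc, reassoc_of% hfg, hfg]
    rw [show g ≫ f = 0 from h, Limits.zero_comp, Limits.comp_zero] at h₁
    have := interval_nontrivial (k := k) hab hbn
    exact zero_ne_one (α := End (interval k n a b)) h₁
  have hmul : e * e = e * 1 := by
    rw [mul_one]
    change (g ≫ f) ≫ g ≫ f = g ≫ f
    rw [Category.assoc, reassoc_of% hfg]
  exact (hV.isUnit_of_ne_zero e he).mul_left_cancel hmul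

theorem IsExceptionalSequence.not_link {m : ℕ} {V : Fin m → QuiverRep k (StraightA n)}
    (hV : IsExceptionalSequence V) {e : Fin m → ℕ × ℕ}
    (he : ∀ i, (e i).1 < (e i).2 ∧ (e i).2 ≤ n) (φ : ∀ i, V i ≅ interval k n (e i).1 (e i).2)
    {i j : Fin m} (hij : j < i) : ¬ Link (e i) (e j) := by
  refine (interval_link_iff (k := k) (he i) (he j)).2 ⟨fun f => ?_,
    (hV.ext_eq_zero i j hij).of_iso (φ i) (φ j)⟩
  have h := hV.hom_eq_zero i j hij ((φ i).hom ≫ f ≫ (φ j).inv)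
  rw [← cancel_epi (φ i).hom, ← cancel_mono (φ j).inv, Category.assoc, h]
  simp

variable (k n) in
/-- The isomorphism class of an interval representation. -/
noncomputable def intervalClass (x : ℕ × ℕ) : RepClass k (StraightA n) :=
  Quotient.mk (isIsomorphicSetoid (QuiverRep k (StraightA n))) (interval k n x.1 x.2)

theorem completeExceptionalSets_eq :
    completeExceptionalSets k (StraightA n) =
      (fun F : Finset (ℕ × ℕ) => intervalClass k n '' (F : Set (ℕ × ℕ))) '' linkOrderedSets n := by
  have hn : Fintype.card (StraightA n) = n := Fintype.card_fin n
  rw [completeExceptionalSets, hn]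
  ext S
  constructor
  · rintro ⟨V, hV, rfl⟩
    choose e he φ using fun i => (hV.exceptional i).exists_iso_interval
    refine ⟨Finset.univ.image e,
      ⟨e, he, fun i j hij => hV.not_link he (fun i => (φ i).some) hij, rfl⟩, ?_⟩
    simp only [Finset.coe_image, Finset.coe_univ, Set.image_univ, ← Set.range_comp]
    congr 1
    ext i
    exact Quotient.sound ⟨(φ i).some.symm⟩
  · rintro ⟨F, ⟨e, he, hlink, rfl⟩, rfl⟩
    refine ⟨fun i => interval k n (e i).1 (e i).2, ⟨fun i => interval_isExceptional (he i).1 (he i).2,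
      fun i j hij => ((interval_link_iff (he i) (he j)).1 (hlink i j hij)).1,
      fun i j hij => ((interval_link_iff (he i) (he j)).1 (hlink i j hij)).2⟩, ?_⟩
    simp only [Finset.coe_image, Finset.coe_univ, Set.image_univ, ← Set.range_comp]
    rfl

theorem injOn_image_intervalClass :
    Set.InjOn (fun F : Finset (ℕ × ℕ) => intervalClass k n '' (F : Set (ℕ × ℕ)))
      (linkOrderedSets n) := by
  have hinj : Set.InjOn (intervalClass k n) {x | x.1 < x.2 ∧ x.2 ≤ n} := fun x hx y hy h => by
    obtain ⟨φ⟩ := Quotient.exact h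
    exact interval_eq_of_iso hx hy φ
  have hsub : ∀ F ∈ linkOrderedSets n, (F : Set (ℕ × ℕ)) ⊆ {x | x.1 < x.2 ∧ x.2 ≤ n} := by
    rintro F ⟨e, he, -, rfl⟩ x hx
    obtain ⟨i, -, rfl⟩ := Finset.mem_image.1 (Finset.mem_coe.1 hx)
    exact he i
  intro F hF G hG h
  exact Finset.coe_injective ((hinj.image_eq_image_iff (hsub F hF) (hsub G hG)).1 h)

end StraightA

theorem mainTheorem2 (k : Type u) [Field k] (n : ℕ) :
    (completeExceptionalSets k (StraightA n)).Finite ∧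
    ((completeExceptionalSets k (StraightA n)).ncard : ℚ) =
      1 / (3 * (n : ℚ) + 1) * (Nat.choose (3 * n + 1) n : ℚ) ∧
    ((completeExceptionalSets k (StraightA n)).ncard : ℚ) =
      1 / (2 * (n : ℚ) + 1) * (Nat.choose (3 * n) n : ℚ) := by
  obtain ⟨hfin, hcard⟩ := linkOrderedSets_count n
  rw [completeExceptionalSets_eq, injOn_image_intervalClass.ncard_image]
  have hchoose := Nat.choose_mul_succ_eq (3 * n) n
  rw [show 3 * n + 1 - n = 2 * n + 1 by omega] at hchoose
  have hchoose' : (Nat.choose (3 * n) n * (3 * n + 1) : ℚ) =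
      Nat.choose (3 * n + 1) n * (2 * n + 1) := by exact_mod_cast hchoose
  have h₃ : (3 * n + 1 : ℚ) ≠ 0 := by positivity
  have h₂ : (2 * n + 1 : ℚ) ≠ 0 := by positivity
  have h₁ : ((linkOrderedSets n).ncard : ℚ) =
      1 / (3 * (n : ℚ) + 1) * (Nat.choose (3 * n + 1) n : ℚ) := by
    rw [← hcard]
    field_simp
  refine ⟨hfin.image _, h₁, ?_⟩
  rw [h₁]
  field_simp
  linarith
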